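/- Let $G=(V,A)$ be a two-terminal series-parallel directed graph with source $s$ and sink $t$ (built from single arcs by series and parallel composition; parallel arcs are allowed). Every arc $a$ has a capacity $u_a$ and a transit time $\tau_a$, both positive integers, and unit cost $c_a=1$. For an $s$-$t$ path $p$ let $\tau_p=\sum_{a\in p}\tau_a$. Let $T\ge 1$ be an integer time horizon. A family $y=(y_p)_p$ of nonnegative real rates on the simple $s$-$t$ paths is a *path decomposition* if $\sum_{p\ni a}y_p\le u_a$ for every arc $a$. The corresponding *temporally repeated flow* $f=f^y$ has the inflow rates $$f_a(\theta)=\sum\{y_p : a=(v,w)\in p,\ \tau(p|_{s,v})\le\theta,\ \tau(p|_{v,t})<T-\theta\}\quad(\theta\in[0,T)),\qquad f_a(\theta)=0\quad(\theta\notin[0,T)),$$ where $p|_{s,v}$ and $p|_{v,t}$ are the parts of $p$ from $s$ to $v$ and from $v$ to $t$. Its value is $$\mathrm{val}(f)=\sum_{a\in\delta^+(s)}\int_0^T f_a(\theta)\,d\theta-\sum_{a\in\delta^-(s)}\int_0^{T-\tau_a}f_a(\theta)\,d\theta,$$ and its peak cost is $$c^{\max}(f)=\max_{\theta\in[0,T)}\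 \sum_{a\in A}c_a\int_{\theta-\tau_a}^{\theta}f_a(\xi)\,d\xi .$$ Let $D\ge 0$ be an integer demand such that some temporally repeated flow with horizon $T$ has value at least $D$. The algorithm MSSP starts with $y=0$. As long as $\mathrm{val}(f^y)\ne D$, it chooses a shortest path $p$ (with respect to $\tau$, ties broken arbitrarily) among the $s$-$t$ paths with positive free capacity $u^{\mathrm{fr}}(p)=\min_{a\in p}\bigl(u_a-\sum_{q\ni a}y_q\bigr)$, and increases $y_p$ by $\min\bigl\{u^{\mathrm{fr}}(p),\,\tfrac{D-\mathrm{val}(f^y)}{T-\tau_p}\bigr\}$. **Theorem.** For every choice of ties, MSSP is well defined (as long as the demand is not met, a path with positive free capacity exists, and every shortest one has $\tau_p<T$), it stops after at most $|A|$ iterations, and the final $y$ is a path decomposition whose temporally repeated flow has value exactly $D$, has a peak cost that is attained at some time point in $[0,T)$, and has minimum peak cost among all temporally repeated flows with horizon $T$ and value at least $D$ (fractional flow rates being allowed). -/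

import Mathlib

noncomputable section

namespace PeakCostFlow

/-- A network over time on a directed (multi)graph with node set `V` and arc set `A`: every arc
has a tail `src`, a head `tgt`, a positive integral capacity, a positive integral transit time and
a nonnegative integral cost; `s` is the source and `t` the sink. -/
structure Network (V A : Type*) where
  src : A → V
  tgt : A → V
  s : V
  t : V
  cap : A → ℕ
  transit : A → ℕ
  cost : A → ℕ
  cap_pos : ∀ a, 0 < cap a
  transit_pos : ∀ a, 0 < transit a

/-- `SPGraph src tgt W S u v`: the graph with node set `W` and arc set `S` is two-terminal
series-parallel with source `u` and sink `v`, i.e. it arises from single arcs (joining two distinct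
nodes) by series composition (the sink of the first graph is identified with the source of the
second) and parallel composition (the two sources and the two sinks are identified). -/
inductive SPGraph {V A : Type*} (src tgt : A → V) : Set V → Set A → V → V → Prop
  | arc (a : A) (h : src a ≠ tgt a) : SPGraph src tgt {src a, tgt a} {a} (src a) (tgt a)
  | series {W₁ W₂ : Set V} {S₁ S₂ : Set A} {u v w : V}
      (h₁ : SPGraph src tgt W₁ S₁ u v) (h₂ : SPGraph src tgt W₂ S₂ v w)
      (hW : W₁ ∩ W₂ = {v}) (hS : Disjoint S₁ S₂) :
      SPGraph src tgt (W₁ ∪ W₂) (S₁ ∪ S₂) u w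
  | parallel {W₁ W₂ : Set V} {S₁ S₂ : Set A} {u v : V}
      (h₁ : SPGraph src tgt W₁ S₁ u v) (h₂ : SPGraph src tgt W₂ S₂ u v)
      (hW : W₁ ∩ W₂ = {u, v}) (hS : Disjoint S₁ S₂) :
      SPGraph src tgt (W₁ ∪ W₂) (S₁ ∪ S₂) u v

namespace Network

variable {V A : Type*}

/-- The graph of the network, with terminals `s` and `t`, is two-terminal series-parallel. -/
def IsSeriesParallel (N : Network V A) : Prop :=
  SPGraph N.src N.tgt Set.univ Set.univ N.s N.t

/-- The arcs of the list `p` form, in this order, a walk from `u` to `v`. -/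
def IsWalk (N : Network V A) : V → List A → V → Prop
  | u, [], v => u = v
  | u, a :: p, v => N.src a = u ∧ N.IsWalk (N.tgt a) p v

/-- The simple `s`-`t` paths, given by their arc sequences. The nodes visited are `s` and the heads
of the arcs; they are pairwise distinct. -/
def STPath (N : Network V A) : Type _ :=
  {p : List A // N.IsWalk N.s p N.t ∧ (N.s :: p.map N.tgt).Nodup}

/-- The arc sequence of a path. -/
def STPath.arcs {N : Network V A} (p : N.STPath) : List A := p.1

instance [Finite A] (N : Network V A) : Finite N.STPath := by
  classical
  have := Fintype.ofFinite A
  refine Finite.of_injective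
    (fun p : N.STPath => (⟨p.1, List.Nodup.of_map _ (List.nodup_cons.1 p.2.2).2⟩ :
      {l : List A // l.Nodup})) ?_
  intro p q h
  exact Subtype.ext (congrArg (fun l : {l : List A // l.Nodup} => l.1) h)

instance [Finite A] (N : Network V A) : Fintype N.STPath := Fintype.ofFinite _

/-- Total transit time of a list of arcs. -/
def listLength (N : Network V A) (l : List A) : ℕ := (l.map N.transit).sum

/-- The transit time (length) of a path. -/
def pathLength (N : Network V A) (p : N.STPath) : ℕ := N.listLength p.arcs

open scoped Classical in
/-- For an arc `a = (v, w)` of the path `p`: the length of the part of `p` from `s` to `v`. -/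
def lengthTo (N : Network V A) (p : N.STPath) (a : A) : ℕ :=
  N.listLength (p.arcs.take (p.arcs.idxOf a))

open scoped Classical in
/-- For an arc `a = (v, w)` of the path `p`: the length of the part of `p` from `v` to `t`
(this part contains `a`). -/
def lengthFrom (N : Network V A) (p : N.STPath) (a : A) : ℕ :=
  N.listLength (p.arcs.drop (p.arcs.idxOf a))

/-- Path `p` contains arc `a` and can transport flow over `a` at time `θ` without violating the
time horizon `T`. -/
def Active (N : Network V A) (T : ℕ) (a : A) (θ : ℝ) (p : N.STPath) : Prop :=
  a ∈ p.arcs ∧ (N.lengthTo p a : ℝ) ≤ θ ∧ (N.lengthFrom p a : ℝ) < (T : ℝ) - θ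

variable [Fintype A]

open scoped Classical in
/-- The static flow on the arcs with path decomposition `y`. -/
def staticFlow (N : Network V A) (y : N.STPath → ℝ) (a : A) : ℝ :=
  ∑ p, if a ∈ p.arcs then y p else 0

/-- `y` is a path decomposition (with nonnegative real rates) of a static `s`-`t` flow that respects
the capacities. -/
def IsPathDecomposition (N : Network V A) (y : N.STPath → ℝ) : Prop :=
  (∀ p, 0 ≤ y p) ∧ ∀ a, N.staticFlow y a ≤ N.cap a

open scoped Classical in
/-- The flow rates of the temporally repeated flow with time horizon `T` that corresponds to the
path decomposition `y`: inflow rate into arc `a` at time `θ`. -/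
def repeatedFlow (N : Network V A) (T : ℕ) (y : N.STPath → ℝ) (a : A) (θ : ℝ) : ℝ :=
  if 0 ≤ θ ∧ θ < T then ∑ p, if N.Active T a θ p then y p else 0 else 0

/-- `f` is a (feasible) temporally repeated flow with time horizon `T`. -/
def IsTemporallyRepeated (N : Network V A) (T : ℕ) (f : A → ℝ → ℝ) : Prop :=
  ∃ y, N.IsPathDecomposition y ∧ f = N.repeatedFlow T y

open scoped Classical in
/-- The value of a flow over time with time horizon `T`. -/
def value (N : Network V A) (T : ℕ) (f : A → ℝ → ℝ) : ℝ :=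
  (∑ a, if N.src a = N.s then ∫ θ in (0 : ℝ)..T, f a θ else 0) -
    ∑ a, if N.tgt a = N.s then ∫ θ in (0 : ℝ)..((T : ℝ) - N.transit a), f a θ else 0

/-- The cost at time point `θ` of a flow over time. -/
def costAt (N : Network V A) (f : A → ℝ → ℝ) (θ : ℝ) : ℝ :=
  ∑ a, (N.cost a : ℝ) * ∫ ϑ in (θ - N.transit a)..θ, f a ϑ

/-- The costs at all time points in `[0, T)`. -/
def costs (N : Network V A) (T : ℕ) (f : A → ℝ → ℝ) : Set ℝ :=
  N.costAt f '' Set.Ico (0 : ℝ) T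

/-- The peak cost of a flow over time with time horizon `T`. -/
def peakCost (N : Network V A) (T : ℕ) (f : A → ℝ → ℝ) : ℝ :=
  sSup (N.costs T f)

/-- The instance with time horizon `T` and demand `D` is feasible: some temporally repeated flow
covers the demand. -/
def Feasible (N : Network V A) (T D : ℕ) : Prop :=
  ∃ f, N.IsTemporallyRepeated T f ∧ (D : ℝ) ≤ N.value T f

/-- `f` is an optimal solution of the Minimum-Peak-Cost Temporally Repeated Flow problem with time
horizon `T` and demand `D`. -/
def IsOptimal (N : Network V A) (T D : ℕ) (f : A → ℝ → ℝ) : Prop :=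
  N.IsTemporallyRepeated T f ∧ (D : ℝ) ≤ N.value T f ∧
    ∀ g, N.IsTemporallyRepeated T g → (D : ℝ) ≤ N.value T g → N.peakCost T f ≤ N.peakCost T g

/-- The remaining free capacity of the path `p` under the path decomposition `y`: the minimum over
the arcs of `p` of the capacity not used by `y`. -/
def freeCap (N : Network V A) (y : N.STPath → ℝ) (p : N.STPath) : ℝ :=
  ⨅ a : {a : A // a ∈ p.arcs}, ((N.cap a.1 : ℝ) - N.staticFlow y a.1)

/-- `p` is a shortest path among the `s`-`t` paths with free capacity. -/
def IsShortestFree (N : Network V A) (y : N.STPath → ℝ) (p : N.STPath) : Prop :=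
  0 < N.freeCap y p ∧ ∀ q, 0 < N.freeCap y q → N.pathLength p ≤ N.pathLength q

open scoped Classical in
/-- Add flow at rate `r` along the path `p`. -/
def addRate (N : Network V A) (y : N.STPath → ℝ) (p : N.STPath) (r : ℝ) : N.STPath → ℝ :=
  fun q => if q = p then y q + r else y q

/-- One iteration of the modified successive shortest path algorithm: if the value of the current
flow is not yet `D`, choose a shortest `s`-`t` path `p` with free capacity (ties are broken
arbitrarily) and add a chain flow along `p` whose rate is the minimum of the free capacity of `p`
and of the rate that is needed to reach the demand. -/
def MSSPStep (N : Network V A) (T D : ℕ) (y y' : N.STPath → ℝ) : Prop :=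
  N.value T (N.repeatedFlow T y) ≠ D ∧
    ∃ p, N.IsShortestFree y p ∧
      y' = N.addRate y p (min (N.freeCap y p)
        (((D : ℝ) - N.value T (N.repeatedFlow T y)) / ((T : ℝ) - N.pathLength p)))

/-- `y 0, y 1, …, y n` are the first `n` iterations of a run of the algorithm, starting with the
empty flow. -/
def MSSPRun (N : Network V A) (T D n : ℕ) (y : ℕ → N.STPath → ℝ) : Prop :=
  (y 0 = fun _ => 0) ∧ ∀ i < n, N.MSSPStep T D (y i) (y (i + 1))

end Network

end PeakCostFlow

end

/-!
Write `τ_p` for the length of a path `p`. A chain flow of unit rate along `p` has value `(T - τ_p)⁺`,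
and its cost at time `θ` is the measure of the entry times in `[0, T - τ_p)` that lie in
`(θ - τ_p, θ]`, because the contributions of the arcs of `p` telescope. This cost is at most
`min τ_p (T - τ_p)⁺`, and at `θ = T / 2` it attains this bound for all paths simultaneously. So both
the value and the peak cost of a temporally repeated flow are linear in the path decomposition
(`value_repeatedFlow`, `isGreatest_costs`), and the problem is to minimize
`∑ y_p * min τ_p (T - τ_p)⁺` subject to `∑ y_p * (T - τ_p)⁺ ≥ D`.

The core is `GreedyRun.sum_mul_max_le`: on a series-parallel graph, greedily chosen shortest paths
maximize `∑ y_p * (K - τ_p)⁺` among all path decompositions as soon as no path shorter than `K` has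
free capacity. An optimal dual solution is built by induction on the graph (`exists_arcWeights`); in
the series case `K` is split into one threshold for each part, which is possible since the chosen
paths are shortest in each part.

With `K = T`, this shows that a path shorter than `T` is free as long as the demand is not met. For
optimality, let `L` be the length of the last path, `K = min L (T / 2)` and `lam` the ratio of
`min L (T - L)` and `T - L`. Then `lam * (T - τ)⁺ - min τ (T - τ)⁺ ≤ (lam + 1) * (K - τ)⁺` for all
`τ`, with equality for `τ ≤ L` (`exists_multiplier`), so that the Lagrangian is maximized by the
computed flow as well (`GreedyRun.sum_mul_peakRate_le`). The bound on the number of iterations holds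
because each iteration but the last saturates an arc.
-/

namespace PeakCostFlow

/-! ### Walks in series-parallel graphs -/

namespace SPGraph

variable {V A : Type*} {src tgt : A → V} {W : Set V} {S : Set A} {u v : V}

theorem source_mem (h : SPGraph src tgt W S u v) : u ∈ W := by
  induction h with
  | arc a h => simp
  | series _ _ _ _ ih₁ _ => exact Or.inl ih₁
  | parallel _ _ _ _ ih₁ _ => exact Or.inl ih₁

theorem sink_mem (h : SPGraph src tgt W S u v) : v ∈ W := by
  induction h with
  | arc a h => simp
  | series _ _ _ _ _ ih₂ => exact Or.inr ih₂
  | parallel _ _ _ _ ih₁ _ => exact Or.inl ih₁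

theorem arc_mem (h : SPGraph src tgt W S u v) : ∀ a ∈ S, src a ∈ W ∧ tgt a ∈ W := by
  induction h with
  | arc a h => simp
  | series _ _ _ _ ih₁ ih₂ =>
    rintro a (ha | ha)
    exacts [⟨Or.inl (ih₁ a ha).1, Or.inl (ih₁ a ha).2⟩, ⟨Or.inr (ih₂ a ha).1, Or.inr (ih₂ a ha).2⟩]
  | parallel _ _ _ _ ih₁ ih₂ =>
    rintro a (ha | ha)
    exacts [⟨Or.inl (ih₁ a ha).1, Or.inl (ih₁ a ha).2⟩, ⟨Or.inr (ih₂ a ha).1, Or.inr (ih₂ a ha).2⟩]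

theorem source_ne_sink (h : SPGraph src tgt W S u v) : u ≠ v := by
  induction h with
  | arc a h => exact h
  | series h₁ h₂ hW _ ih₁ _ =>
    rintro rfl
    exact ih₁ (hW.subset ⟨h₁.source_mem, h₂.sink_mem⟩)
  | parallel _ _ _ _ ih₁ _ => exact ih₁

/-- No arc enters the source and no arc leaves the sink. -/
theorem tgt_ne_source_and_src_ne_sink (h : SPGraph src tgt W S u v) :
    ∀ a ∈ S, tgt a ≠ u ∧ src a ≠ v := by
  induction h with
  | arc a h => rintro _ rfl; exact ⟨h.symm, h⟩
  | @series W₁ W₂ S₁ S₂ u v w h₁ h₂ hW _ ih₁ ih₂ =>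
    rintro a (ha | ha)
    · refine ⟨(ih₁ a ha).1, fun he => ?_⟩
      have : w ∈ W₁ := he ▸ (h₁.arc_mem a ha).1
      exact h₂.source_ne_sink (hW.subset ⟨this, h₂.sink_mem⟩).symm
    · refine ⟨fun he => ?_, (ih₂ a ha).2⟩
      have : u ∈ W₂ := he ▸ (h₂.arc_mem a ha).2
      exact h₁.source_ne_sink (hW.subset ⟨h₁.source_mem, this⟩)
  | parallel _ _ _ _ ih₁ ih₂ =>
    rintro a (ha | ha)
    exacts [ih₁ a ha, ih₂ a ha]

end SPGraph

namespace Network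

variable {V A : Type*} {N : Network V A}

theorem IsWalk.append {u v w : V} {l₁ l₂ : List A} (h₁ : N.IsWalk u l₁ v) (h₂ : N.IsWalk v l₂ w) :
    N.IsWalk u (l₁ ++ l₂) w := by
  induction l₁ generalizing u with
  | nil => cases h₁; exact h₂
  | cons a l ih => exact ⟨h₁.1, ih h₁.2⟩

theorem listLength_append (l₁ l₂ : List A) :
    N.listLength (l₁ ++ l₂) = N.listLength l₁ + N.listLength l₂ := by
  simp [listLength]

/-- The list `l` is a walk from `u` to `v` all of whose arcs belong to `S`. -/
def IsWalkIn (N : Network V A) (S : Set A) (u : V) (l : List A) (v : V) : Prop :=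
  N.IsWalk u l v ∧ ∀ a ∈ l, a ∈ S

theorem IsWalkIn.mono {S S' : Set A} {u v : V} {l : List A} (h : N.IsWalkIn S u l v)
    (hS : S ⊆ S') : N.IsWalkIn S' u l v :=
  ⟨h.1, fun a ha => hS (h.2 a ha)⟩

theorem IsWalkIn.append {S : Set A} {u v w : V} {l₁ l₂ : List A} (h₁ : N.IsWalkIn S u l₁ v)
    (h₂ : N.IsWalkIn S v l₂ w) : N.IsWalkIn S u (l₁ ++ l₂) w :=
  ⟨h₁.1.append h₂.1, fun a ha => (List.mem_append.1 ha).elim (h₁.2 a) (h₂.2 a)⟩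

theorem _root_.PeakCostFlow.SPGraph.exists_isWalkIn {W : Set V} {S : Set A} {u v : V}
    (h : SPGraph N.src N.tgt W S u v) : ∃ l, N.IsWalkIn S u l v := by
  induction h with
  | arc a h => exact ⟨[a], ⟨rfl, rfl⟩, by simp⟩
  | series _ _ _ _ ih₁ ih₂ =>
    obtain ⟨l₁, hl₁⟩ := ih₁
    obtain ⟨l₂, hl₂⟩ := ih₂
    exact ⟨l₁ ++ l₂, (hl₁.mono Set.subset_union_left).append (hl₂.mono Set.subset_union_right)⟩
  | parallel _ _ _ _ ih₁ _ =>
    obtain ⟨l, hl⟩ := ih₁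
    exact ⟨l, hl.mono Set.subset_union_left⟩

section Decomposition

variable {W₁ W₂ : Set V} {S₁ S₂ : Set A} {u v w : V}

/-- In a series composition, no walk returns from the second part to the first. -/
theorem isWalkIn_right_of_series (h₁ : SPGraph N.src N.tgt W₁ S₁ u v)
    (h₂ : SPGraph N.src N.tgt W₂ S₂ v w) (hW : W₁ ∩ W₂ = {v}) {x y : V} {l : List A}
    (hl : N.IsWalkIn (S₁ ∪ S₂) x l y) (hx : x ∈ W₂) : N.IsWalkIn S₂ x l y := by
  induction l generalizing x with
  | nil => exact ⟨hl.1, by simp⟩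
  | cons a l ih =>
    obtain ⟨⟨rfl, hl⟩, hS⟩ := hl
    have ha : a ∈ S₂ := (hS a (by simp)).resolve_left fun ha =>
      (h₁.tgt_ne_source_and_src_ne_sink a ha).2 (hW.subset ⟨(h₁.arc_mem a ha).1, hx⟩)
    have := ih ⟨hl, fun b hb => hS b (by simp [hb])⟩ (h₂.arc_mem a ha).2
    refine ⟨⟨rfl, hl⟩, fun b hb => ?_⟩
    rcases List.mem_cons.1 hb with rfl | hb
    exacts [ha, this.2 b hb]

/-- In a series composition, a walk from the first part to the second passes through the common
node. -/
theorem exists_append_of_series (h₁ : SPGraph N.src N.tgt W₁ S₁ u v)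
    (h₂ : SPGraph N.src N.tgt W₂ S₂ v w) (hW : W₁ ∩ W₂ = {v}) {x y : V} {l : List A}
    (hl : N.IsWalkIn (S₁ ∪ S₂) x l y) (hx : x ∈ W₁) (hy : y ∈ W₂) :
    ∃ l₁ l₂, l = l₁ ++ l₂ ∧ N.IsWalkIn S₁ x l₁ v ∧ N.IsWalkIn S₂ v l₂ y := by
  induction l generalizing x with
  | nil =>
    obtain ⟨rfl : x = y, -⟩ := hl
    obtain rfl : x = v := hW.subset ⟨hx, hy⟩
    exact ⟨[], [], rfl, ⟨rfl, by simp⟩, ⟨rfl, by simp⟩⟩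
  | cons a l ih =>
    by_cases ha : a ∈ S₁
    · obtain ⟨⟨rfl, hl⟩, hS⟩ := hl
      obtain ⟨l₁, l₂, rfl, hl₁, hl₂⟩ :=
        ih ⟨hl, fun b hb => hS b (by simp [hb])⟩ (h₁.arc_mem a ha).2
      refine ⟨a :: l₁, l₂, rfl, ⟨⟨rfl, hl₁.1⟩, fun b hb => ?_⟩, hl₂⟩
      rcases List.mem_cons.1 hb with rfl | hb
      exacts [ha, hl₁.2 b hb]
    · have ha₂ : a ∈ S₂ := (hl.2 a (by simp)).resolve_left ha
      have hxv : x = v := hW.subset ⟨hx, hl.1.1 ▸ (h₂.arc_mem a ha₂).1⟩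
      have := isWalkIn_right_of_series h₁ h₂ hW hl (hxv ▸ h₂.source_mem)
      subst hxv
      exact ⟨[], a :: l, rfl, ⟨rfl, by simp⟩, this⟩

/-- In a parallel composition, a walk that starts in the first part, but not at the source, stays in
this part: it could leave it only at the sink, where no arc begins. -/
theorem isWalkIn_left_of_parallel (h₁ : SPGraph N.src N.tgt W₁ S₁ u v)
    (h₂ : SPGraph N.src N.tgt W₂ S₂ u v) (hW : W₁ ∩ W₂ = {u, v}) {x y : V} {l : List A}
    (hl : N.IsWalkIn (S₁ ∪ S₂) x l y) (hx : x ∈ W₁) (hxu : x ≠ u) : N.IsWalkIn S₁ x l y := by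
  induction l generalizing x with
  | nil => exact ⟨hl.1, by simp⟩
  | cons a l ih =>
    obtain ⟨⟨rfl, hl⟩, hS⟩ := hl
    have ha : a ∈ S₁ := (hS a (by simp)).resolve_right fun ha =>
      (h₂.tgt_ne_source_and_src_ne_sink a ha).2
        ((hW.subset ⟨hx, (h₂.arc_mem a ha).1⟩).resolve_left hxu)
    have := ih ⟨hl, fun b hb => hS b (by simp [hb])⟩ (h₁.arc_mem a ha).2
      (h₁.tgt_ne_source_and_src_ne_sink a ha).1
    refine ⟨⟨rfl, hl⟩, fun b hb => ?_⟩
    rcases List.mem_cons.1 hb with rfl | hb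
    exacts [ha, this.2 b hb]

/-- In a parallel composition, a walk from source to sink stays in one of the two parts. -/
theorem isWalkIn_or_of_parallel (h₁ : SPGraph N.src N.tgt W₁ S₁ u v)
    (h₂ : SPGraph N.src N.tgt W₂ S₂ u v) (hW : W₁ ∩ W₂ = {u, v}) {l : List A}
    (hl : N.IsWalkIn (S₁ ∪ S₂) u l v) : N.IsWalkIn S₁ u l v ∨ N.IsWalkIn S₂ u l v := by
  cases l with
  | nil => exact (h₁.source_ne_sink hl.1).elim
  | cons a l =>
    obtain ⟨⟨hu, hl⟩, hS⟩ := hl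
    have hS' : ∀ b ∈ l, b ∈ S₁ ∪ S₂ := fun b hb => hS b (by simp [hb])
    rcases hS a (by simp) with ha | ha
    · have := isWalkIn_left_of_parallel h₁ h₂ hW ⟨hl, hS'⟩ (h₁.arc_mem a ha).2
        (h₁.tgt_ne_source_and_src_ne_sink a ha).1
      refine Or.inl ⟨⟨hu, hl⟩, fun b hb => ?_⟩
      rcases List.mem_cons.1 hb with rfl | hb
      exacts [ha, this.2 b hb]
    · have := isWalkIn_left_of_parallel h₂ h₁ (Set.inter_comm _ _ ▸ hW)
        ⟨hl, Set.union_comm S₁ S₂ ▸ hS'⟩ (h₂.arc_mem a ha).2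
        (h₂.tgt_ne_source_and_src_ne_sink a ha).1
      refine Or.inr ⟨⟨hu, hl⟩, fun b hb => ?_⟩
      rcases List.mem_cons.1 hb with rfl | hb
      exacts [ha, this.2 b hb]

end Decomposition

theorem eq_singleton_of_isWalkIn {a : A} (h : N.src a ≠ N.tgt a) {l : List A}
    (hl : N.IsWalkIn {a} (N.src a) l (N.tgt a)) : l = [a] := by
  obtain ⟨hl, hS⟩ := hl
  match l, hl, hS with
  | [], hl, _ => exact (h hl).elim
  | [b], _, hS => rw [show b = a from hS b (by simp)]
  | b :: c :: l, hl, hS =>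
    obtain rfl : b = a := hS b (by simp)
    obtain rfl : c = b := hS c (by simp)
    exact (h hl.2.1).elim

/-- A series-parallel graph is acyclic: every walk from source to sink is simple. -/
theorem IsWalkIn.nodup {W : Set V} {S : Set A} {u v : V} (h : SPGraph N.src N.tgt W S u v)
    {l : List A} (hl : N.IsWalkIn S u l v) : (u :: l.map N.tgt).Nodup := by
  induction h generalizing l with
  | arc a h =>
    rw [eq_singleton_of_isWalkIn h hl]
    simpa using h
  | @series W₁ W₂ S₁ S₂ u v w h₁ h₂ hW _ ih₁ ih₂ =>
    obtain ⟨l₁, l₂, rfl, hl₁, hl₂⟩ :=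
      exists_append_of_series h₁ h₂ hW hl h₁.source_mem h₂.sink_mem
    have hd₂ := List.nodup_cons.1 (ih₂ hl₂)
    rw [List.map_append, ← List.cons_append, List.nodup_append]
    refine ⟨ih₁ hl₁, hd₂.2, ?_⟩
    rintro x hx y hy rfl
    have hx₁ : x ∈ W₁ := by
      rcases List.mem_cons.1 hx with rfl | hx
      · exact h₁.source_mem
      · obtain ⟨a, ha, rfl⟩ := List.mem_map.1 hx
        exact (h₁.arc_mem a (hl₁.2 a ha)).2
    have hx₂ : x ∈ W₂ := by
      obtain ⟨a, ha, rfl⟩ := List.mem_map.1 hy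
      exact (h₂.arc_mem a (hl₂.2 a ha)).2
    obtain rfl : x = v := hW.subset ⟨hx₁, hx₂⟩
    exact hd₂.1 hy
  | parallel h₁ h₂ hW _ ih₁ ih₂ =>
    exact (isWalkIn_or_of_parallel h₁ h₂ hW hl).elim (fun h => ih₁ h) (fun h => ih₂ h)

/-! ### Dual weights for greedily chosen paths -/

/-- Total weight of a list of arcs under `w`. -/
def weight (w : A → ℝ) (l : List A) : ℝ := (l.map w).sum

theorem weight_congr {w w' : A → ℝ} {l : List A} (h : ∀ a ∈ l, w a = w' a) :
    weight w l = weight w' l := by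
  rw [weight, weight, List.map_congr_left h]

theorem weight_append (w : A → ℝ) (l₁ l₂ : List A) :
    weight w (l₁ ++ l₂) = weight w l₁ + weight w l₂ := by
  simp [weight]

open scoped Classical in
/-- Let `p i` (`i ∈ I`) be walks from source to sink, each of them shortest among those whose arcs
lie in `F i`, where the sets `F i` decrease with `i`. If the chosen walks have length at most `K` and
the walks left in `F n` have length at least `K`, then there are nonnegative arc weights, vanishing
on `F n`, under which every walk `q` weighs at least `K - τ_q`, with equality for the chosen ones.
Here `F i` stands for the arcs unsaturated after `i` iterations of a greedy algorithm.

Both compositions preserve the hypotheses. The order of the choices matters only for the series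
composition: the walks chosen last are longest in both parts at once, and this leaves room to
split `K` into a threshold for each part. -/
theorem exists_arcWeights {W : Set V} {S : Set A} {u v : V}
    (h : SPGraph N.src N.tgt W S u v) {n : ℕ} {F : ℕ → Set A}
    (hF : ∀ i j, i ≤ j → j ≤ n → F j ⊆ F i) {I : Set ℕ} (hI : ∀ i ∈ I, i ≤ n)
    {p : ℕ → List A} {K : ℝ}
    (hp : ∀ i ∈ I, N.IsWalkIn (S ∩ F i) u (p i) v)
    (hmin : ∀ i ∈ I, ∀ q, N.IsWalkIn (S ∩ F i) u q v → N.listLength (p i) ≤ N.listLength q)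
    (hpK : ∀ i ∈ I, (N.listLength (p i) : ℝ) ≤ K)
    (hK : ∀ q, N.IsWalkIn (S ∩ F n) u q v → K ≤ N.listLength q) :
    ∃ w : A → ℝ, (∀ a, 0 ≤ w a) ∧ (∀ a ∈ S, 0 < w a → a ∉ F n) ∧
      (∀ q, N.IsWalkIn S u q v → K - N.listLength q ≤ weight w q) ∧
      ∀ i ∈ I, weight w (p i) = K - N.listLength (p i) := by
  induction h generalizing I p K with
  | arc a h =>
    have hp' : ∀ i ∈ I, p i = [a] := fun i hi =>
      eq_singleton_of_isWalkIn h ((hp i hi).mono Set.inter_subset_left)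
    by_cases ha : a ∈ F n
    · have hKa := hK [a] ⟨⟨rfl, rfl⟩, by simpa using ha⟩
      refine ⟨fun _ => 0, fun _ => le_rfl, by simp, ?_, ?_⟩
      · intro q hq
        rw [eq_singleton_of_isWalkIn h hq]
        simpa [weight] using hKa
      · intro i hi
        have := hpK i hi
        rw [hp' i hi] at this ⊢
        simp only [weight, List.map_cons, List.map_nil, List.sum_cons, List.sum_nil]
        linarith
    · refine ⟨fun _ => max (K - N.listLength [a]) 0, fun _ => le_max_right _ _, ?_, ?_, ?_⟩
      · rintro _ rfl _
        exact ha
      · intro q hq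
        rw [eq_singleton_of_isWalkIn h hq]
        simp [weight]
      · intro i hi
        have := hpK i hi
        rw [hp' i hi] at this ⊢
        simpa [weight] using this
  | @series W₁ W₂ S₁ S₂ u v w h₁ h₂ hW hS ih₁ ih₂ =>
    have hsplit : ∀ i, ∃ l : List A × List A, i ∈ I → p i = l.1 ++ l.2 ∧
        N.IsWalkIn (S₁ ∩ F i) u l.1 v ∧ N.IsWalkIn (S₂ ∩ F i) v l.2 w := by
      intro i
      by_cases hi : i ∈ I
      · obtain ⟨l₁, l₂, he, hl₁, hl₂⟩ := exists_append_of_series h₁ h₂ hW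
          ((hp i hi).mono Set.inter_subset_left) h₁.source_mem h₂.sink_mem
        have hf : ∀ a ∈ l₁ ++ l₂, a ∈ F i := fun a ha => ((hp i hi).2 a (he ▸ ha)).2
        exact ⟨(l₁, l₂), fun _ => ⟨he, ⟨hl₁.1, fun a ha => ⟨hl₁.2 a ha, hf a (by simp [ha])⟩⟩,
          ⟨hl₂.1, fun a ha => ⟨hl₂.2 a ha, hf a (by simp [ha])⟩⟩⟩⟩
      · exact ⟨([], []), fun h => (hi h).elim⟩
    choose l hl using hsplit
    have hlen : ∀ i ∈ I, (N.listLength (p i) : ℝ) =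
        N.listLength (l i).1 + N.listLength (l i).2 := by
      intro i hi
      rw [(hl i hi).1, listLength_append, Nat.cast_add]
    have hmono₁ : ∀ i, S₁ ∩ F i ⊆ (S₁ ∪ S₂) ∩ F i := fun i => by gcongr; simp
    have hmono₂ : ∀ i, S₂ ∩ F i ⊆ (S₁ ∪ S₂) ∩ F i := fun i => by gcongr; simp
    have hmin₁ : ∀ i ∈ I, ∀ q, N.IsWalkIn (S₁ ∩ F i) u q v →
        N.listLength (l i).1 ≤ N.listLength q := by
      intro i hi q hq
      have := hmin i hi (q ++ (l i).2)
        ((hq.mono (hmono₁ i)).append ((hl i hi).2.2.mono (hmono₂ i)))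
      rw [(hl i hi).1, listLength_append, listLength_append] at this
      omega
    have hmin₂ : ∀ i ∈ I, ∀ q, N.IsWalkIn (S₂ ∩ F i) v q w →
        N.listLength (l i).2 ≤ N.listLength q := by
      intro i hi q hq
      have := hmin i hi ((l i).1 ++ q)
        (((hl i hi).2.1.mono (hmono₁ i)).append (hq.mono (hmono₂ i)))
      rw [(hl i hi).1, listLength_append, listLength_append] at this
      omega
    have hFi : ∀ (S : Set A) (i j : ℕ), i ≤ j → j ≤ n → S ∩ F j ⊆ S ∩ F i :=
      fun S i j hij hj => Set.inter_subset_inter_right S (hF i j hij hj)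
    -- Of two chosen walks, the later one is at least as long in both parts.
    have hcross : ∀ i ∈ I, ∀ j ∈ I,
        (N.listLength (l i).1 : ℝ) + N.listLength (l j).2 ≤ K := by
      intro i hi j hj
      rcases le_total i j with hij | hij
      · have h1 : (N.listLength (l i).1 : ℝ) ≤ N.listLength (l j).1 := by
          exact_mod_cast hmin₁ i hi _ ((hl j hj).2.1.mono (hFi _ i j hij (hI j hj)))
        linarith [hpK j hj, hlen j hj]
      · have h1 : (N.listLength (l j).2 : ℝ) ≤ N.listLength (l i).2 := by
          exact_mod_cast hmin₂ j hj _ ((hl i hi).2.2.mono (hFi _ j i hij (hI i hi)))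
        linarith [hpK i hi, hlen i hi]
    -- `K₁` and `K - K₁` have to separate chosen from free walks in the two parts. The bounds `0` and
    -- `|K|` only make the two sets nonempty.
    obtain ⟨K₁, hL, hU⟩ : ∃ K₁ : ℝ, (∀ x ∈ {x : ℝ | x = 0 ∨ (∃ i ∈ I, x = N.listLength (l i).1) ∨
          ∃ q, N.IsWalkIn (S₂ ∩ F n) v q w ∧ x = K - N.listLength q}, x ≤ K₁) ∧
        ∀ x ∈ {x : ℝ | x = |K| ∨ (∃ i ∈ I, x = K - N.listLength (l i).2) ∨
          ∃ q, N.IsWalkIn (S₁ ∩ F n) u q v ∧ x = N.listLength q}, K₁ ≤ x := by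
      have hne₁ : {x : ℝ | x = 0 ∨ (∃ i ∈ I, x = N.listLength (l i).1) ∨
          ∃ q, N.IsWalkIn (S₂ ∩ F n) v q w ∧ x = K - N.listLength q}.Nonempty := ⟨0, Or.inl rfl⟩
      have hne₂ : {x : ℝ | x = |K| ∨ (∃ i ∈ I, x = K - N.listLength (l i).2) ∨
          ∃ q, N.IsWalkIn (S₁ ∩ F n) u q v ∧ x = N.listLength q}.Nonempty := ⟨|K|, Or.inl rfl⟩
      obtain ⟨c, hc₁, hc₂⟩ := exists_between_of_forall_le hne₁ hne₂ (by
        have hnn : ∀ l : List A, (0 : ℝ) ≤ N.listLength l := fun l => Nat.cast_nonneg _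
        rintro x (rfl | ⟨i, hi, rfl⟩ | ⟨q, hq, rfl⟩) y (rfl | ⟨j, hj, rfl⟩ | ⟨r, hr, rfl⟩)
        · exact abs_nonneg _
        · linarith [hpK j hj, hlen j hj, hnn (l j).1]
        · exact hnn _
        · linarith [hpK i hi, hlen i hi, hnn (l i).2, le_abs_self K]
        · linarith [hcross i hi j hj]
        · exact_mod_cast hmin₁ i hi r (hr.mono (hFi _ i n (hI i hi) le_rfl))
        · linarith [hnn q, le_abs_self K]
        · have : (N.listLength (l j).2 : ℝ) ≤ N.listLength q := by
            exact_mod_cast hmin₂ j hj q (hq.mono (hFi _ j n (hI j hj) le_rfl))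
          linarith
        · have := hK _ ((hr.mono (hmono₁ n)).append (hq.mono (hmono₂ n)))
          rw [listLength_append, Nat.cast_add] at this
          linarith)
      exact ⟨c, fun x hx => hc₁ hx, fun x hx => hc₂ hx⟩
    obtain ⟨w₁, hw₁0, hw₁F, hw₁, hw₁p⟩ := ih₁ hI (p := fun i => (l i).1) (K := K₁)
      (fun i hi => (hl i hi).2.1) hmin₁ (fun i hi => hL _ (Or.inr (Or.inl ⟨i, hi, rfl⟩)))
      (fun q hq => hU _ (Or.inr (Or.inr ⟨q, hq, rfl⟩)))
    obtain ⟨w₂, hw₂0, hw₂F, hw₂, hw₂p⟩ := ih₂ hI (p := fun i => (l i).2) (K := K - K₁)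
      (fun i hi => (hl i hi).2.2) hmin₂
      (fun i hi => by linarith [hU _ (Or.inr (Or.inl ⟨i, hi, rfl⟩))])
      (fun q hq => by linarith [hL _ (Or.inr (Or.inr ⟨q, hq, rfl⟩))])
    have hS₂ : ∀ a ∈ S₂, a ∉ S₁ := fun a ha ha' => hS.ne_of_mem ha' ha rfl
    have hwt : ∀ l₁ l₂, (∀ a ∈ l₁, a ∈ S₁) → (∀ a ∈ l₂, a ∈ S₂) →
        weight (fun a => if a ∈ S₁ then w₁ a else w₂ a) (l₁ ++ l₂) =
          weight w₁ l₁ + weight w₂ l₂ := by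
      intro l₁ l₂ hl₁ hl₂
      rw [weight_append, weight_congr (w' := w₁) fun a ha => if_pos (hl₁ a ha),
        weight_congr (w' := w₂) fun a ha => if_neg (hS₂ a (hl₂ a ha))]
    refine ⟨fun a => if a ∈ S₁ then w₁ a else w₂ a, ?_, ?_, ?_, ?_⟩
    · intro a
      dsimp only
      split_ifs
      exacts [hw₁0 a, hw₂0 a]
    · rintro a (ha | ha) hpos
      · exact hw₁F a ha (by simpa [ha] using hpos)
      · exact hw₂F a ha (by simpa [hS₂ a ha] using hpos)
    · intro q hq
      obtain ⟨l₁, l₂, rfl, hl₁, hl₂⟩ :=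
        exists_append_of_series h₁ h₂ hW hq h₁.source_mem h₂.sink_mem
      rw [hwt l₁ l₂ hl₁.2 hl₂.2, listLength_append, Nat.cast_add]
      linarith [hw₁ l₁ hl₁, hw₂ l₂ hl₂]
    · intro i hi
      rw [hlen i hi, (hl i hi).1, hwt _ _ (fun a ha => ((hl i hi).2.1.2 a ha).1)
        (fun a ha => ((hl i hi).2.2.2 a ha).1), hw₁p i hi, hw₂p i hi]
      ring
  | @parallel W₁ W₂ S₁ S₂ u v h₁ h₂ hW hS ih₁ ih₂ =>
    have hmono₁ : ∀ i, S₁ ∩ F i ⊆ (S₁ ∪ S₂) ∩ F i := fun i => by gcongr; simp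
    have hmono₂ : ∀ i, S₂ ∩ F i ⊆ (S₁ ∪ S₂) ∩ F i := fun i => by gcongr; simp
    obtain ⟨w₁, hw₁0, hw₁F, hw₁, hw₁p⟩ := ih₁ (I := {i ∈ I | N.IsWalkIn S₁ u (p i) v})
      (fun i hi => hI i hi.1) (p := p) (K := K)
      (fun i hi => ⟨hi.2.1, fun a ha => ⟨hi.2.2 a ha, ((hp i hi.1).2 a ha).2⟩⟩)
      (fun i hi q hq => hmin i hi.1 q (hq.mono (hmono₁ i))) (fun i hi => hpK i hi.1)
      (fun q hq => hK q (hq.mono (hmono₁ n)))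
    obtain ⟨w₂, hw₂0, hw₂F, hw₂, hw₂p⟩ := ih₂ (I := {i ∈ I | N.IsWalkIn S₂ u (p i) v})
      (fun i hi => hI i hi.1) (p := p) (K := K)
      (fun i hi => ⟨hi.2.1, fun a ha => ⟨hi.2.2 a ha, ((hp i hi.1).2 a ha).2⟩⟩)
      (fun i hi q hq => hmin i hi.1 q (hq.mono (hmono₂ i))) (fun i hi => hpK i hi.1)
      (fun q hq => hK q (hq.mono (hmono₂ n)))
    have hS₂ : ∀ a ∈ S₂, a ∉ S₁ := fun a ha ha' => hS.ne_of_mem ha' ha rfl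
    have hwt₁ : ∀ l, (∀ a ∈ l, a ∈ S₁) →
        weight (fun a => if a ∈ S₁ then w₁ a else w₂ a) l = weight w₁ l :=
      fun l hl => weight_congr fun a ha => if_pos (hl a ha)
    have hwt₂ : ∀ l, (∀ a ∈ l, a ∈ S₂) →
        weight (fun a => if a ∈ S₁ then w₁ a else w₂ a) l = weight w₂ l :=
      fun l hl => weight_congr fun a ha => if_neg (hS₂ a (hl a ha))
    refine ⟨fun a => if a ∈ S₁ then w₁ a else w₂ a, ?_, ?_, ?_, ?_⟩
    · intro a
      dsimp only
      split_ifs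
      exacts [hw₁0 a, hw₂0 a]
    · rintro a (ha | ha) hpos
      · exact hw₁F a ha (by simpa [ha] using hpos)
      · exact hw₂F a ha (by simpa [hS₂ a ha] using hpos)
    · intro q hq
      rcases isWalkIn_or_of_parallel h₁ h₂ hW hq with hq | hq
      · rw [hwt₁ q hq.2]; exact hw₁ q hq
      · rw [hwt₂ q hq.2]; exact hw₂ q hq
    · intro i hi
      rcases isWalkIn_or_of_parallel h₁ h₂ hW ((hp i hi).mono Set.inter_subset_left) with hq | hq
      · rw [hwt₁ _ hq.2]; exact hw₁p i ⟨hi, hq⟩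
      · rw [hwt₂ _ hq.2]; exact hw₂p i ⟨hi, hq⟩

end Network

/-! ### Value and peak cost of temporally repeated flows -/

open MeasureTheory

/-- The length of `[0, c) ∩ (-∞, x]`, for `c ≥ 0`: the antiderivative of the indicator function
of `[0, c)` that vanishes at `0`. -/
def ramp (c x : ℝ) : ℝ := min (max x 0) c

theorem integral_ite_le_lt {α β : ℝ} (h : α ≤ β) (b d r : ℝ) :
    ∫ x in α..β, (if b ≤ x ∧ x < d then r else 0) =
      r * (ramp (max (d - b) 0) (β - b) - ramp (max (d - b) 0) (α - b)) := by
  have h1 : (fun x => if b ≤ x ∧ x < d then r else 0) = (Set.Ico b d).indicator fun _ => r := by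
    ext x
    simp [Set.indicator_apply]
  have h2 : (Set.Ioc α β ∩ Set.Ico b d : Set ℝ) =ᵐ[volume] Set.Ioc (max α b) (min β d) := by
    rw [← Set.Ioc_inter_Ioc]
    exact (ae_eq_refl _).inter Ico_ae_eq_Ioc
  rw [intervalIntegral.integral_of_le h, h1, setIntegral_indicator measurableSet_Ico,
    setIntegral_const, measureReal_congr h2, Real.volume_real_Ioc, smul_eq_mul, mul_comm]
  congr 1
  unfold ramp
  grind

theorem intervalIntegrable_ite_le_lt (α β b d r : ℝ) :
    IntervalIntegrable (fun x => if b ≤ x ∧ x < d then r else 0) volume α β := by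
  have h1 : (fun x => if b ≤ x ∧ x < d then r else 0) = (Set.Ico b d).indicator fun _ => r := by
    ext x
    simp [Set.indicator_apply]
  rw [h1]
  exact ⟨(integrableOn_const (by simp)).indicator measurableSet_Ico,
    (integrableOn_const (by simp)).indicator measurableSet_Ico⟩

theorem ramp_sub_ramp_le {c x l : ℝ} (hc : 0 ≤ c) (hl : 0 ≤ l) :
    ramp c x - ramp c (x - l) ≤ min l c := by
  unfold ramp
  grind

/-- The bound `ramp_sub_ramp_le` is attained at `x = T / 2`, whatever the length `l` is. -/
theorem ramp_half_sub_ramp (T l : ℝ) (hl : 0 ≤ l) :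
    ramp (max (T - l) 0) (T / 2) - ramp (max (T - l) 0) (T / 2 - l) = min l (max (T - l) 0) := by
  unfold ramp
  grind

namespace Network

variable {V A : Type*} {N : Network V A}

open scoped Classical in
/-- Along a list of arcs, the increments of `g` between the entry time and the exit time of each arc
add up to the increment over the whole list. -/
theorem sum_map_telescope (g : ℝ → ℝ) {l : List A} (hl : l.Nodup) :
    (l.map fun a => g (N.listLength (l.take (l.idxOf a))) -
      g (N.listLength (l.take (l.idxOf a)) + N.transit a)).sum = g 0 - g (N.listLength l) := by
  induction l generalizing g with
  | nil => simp [listLength]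
  | cons b l ih =>
    obtain ⟨hb, hl⟩ := List.nodup_cons.1 hl
    have hrest : (l.map fun a => g (N.listLength ((b :: l).take ((b :: l).idxOf a))) -
          g (N.listLength ((b :: l).take ((b :: l).idxOf a)) + N.transit a)) =
        l.map fun a => g (N.transit b + N.listLength (l.take (l.idxOf a))) -
          g (N.transit b + (N.listLength (l.take (l.idxOf a)) + N.transit a)) := by
      refine List.map_congr_left fun a ha => ?_
      have hab : b ≠ a := fun h => hb (h ▸ ha)
      rw [List.idxOf_cons_ne _ hab]
      simp [listLength, add_assoc]
    rw [List.map_cons, List.sum_cons, hrest, ih (fun x => g (N.transit b + x)) hl]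
    simp [listLength]

namespace STPath

theorem nodup_arcs (p : N.STPath) : p.arcs.Nodup :=
  List.Nodup.of_map _ (List.nodup_cons.1 p.2.2).2

theorem tgt_ne_source (p : N.STPath) {a : A} (ha : a ∈ p.arcs) : N.tgt a ≠ N.s :=
  fun h => (List.nodup_cons.1 p.2.2).1 (List.mem_map.2 ⟨a, ha, h⟩)

end STPath

theorem lengthTo_add_lengthFrom (p : N.STPath) (a : A) :
    N.lengthTo p a + N.lengthFrom p a = N.pathLength p := by
  rw [lengthTo, lengthFrom, ← listLength_append, List.take_append_drop, pathLength]

theorem src_ne_of_isWalk_of_nodup {u v x : V} {l : List A} (hl : N.IsWalk u l v)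
    (hu : u ≠ x) (hx : x ∉ l.map N.tgt) : ∀ a ∈ l, N.src a ≠ x := by
  induction l generalizing u with
  | nil => simp
  | cons b l ih =>
    obtain ⟨rfl, hl⟩ := hl
    simp only [List.map_cons, List.mem_cons, not_or] at hx
    intro a ha
    rcases List.mem_cons.1 ha with rfl | ha
    exacts [hu, ih hl (Ne.symm hx.1) hx.2 a ha]

/-- The time span in which flow can enter the path `p` and reach the sink before the time
horizon. -/
def slack (N : Network V A) (T : ℕ) (p : N.STPath) : ℝ := max ((T : ℝ) - N.pathLength p) 0

/-- The peak cost of a chain flow of unit rate along the path `p`, for unit costs. -/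
def peakRate (N : Network V A) (T : ℕ) (p : N.STPath) : ℝ :=
  min (N.pathLength p : ℝ) (N.slack T p)

theorem slack_nonneg (T : ℕ) (p : N.STPath) : 0 ≤ N.slack T p := le_max_right _ _

theorem peakRate_nonneg (T : ℕ) (p : N.STPath) : 0 ≤ N.peakRate T p :=
  le_min (Nat.cast_nonneg _) (slack_nonneg T p)

variable [Fintype A]

open scoped Classical in
theorem sum_ite_mem_eq (l : List A) (hl : l.Nodup) (f : A → ℝ) :
    ∑ a, (if a ∈ l then f a else 0) = (l.map f).sum := by
  rw [← List.sum_toFinset f hl, ← Finset.sum_filter]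
  congr 1
  ext a
  simp

open scoped Classical in
/-- The restriction to `[0, T)` in the definition of the flow rates is redundant. -/
theorem repeatedFlow_eq_sum (T : ℕ) (y : N.STPath → ℝ) (a : A) (θ : ℝ) :
    N.repeatedFlow T y a θ = ∑ p, if a ∈ p.arcs then
      (if (N.lengthTo p a : ℝ) ≤ θ ∧ θ < (T : ℝ) - N.lengthFrom p a then y p else 0) else 0 := by
  have key : ∀ p, (if N.Active T a θ p then y p else 0) = if a ∈ p.arcs then
      (if (N.lengthTo p a : ℝ) ≤ θ ∧ θ < (T : ℝ) - N.lengthFrom p a then y p else 0) else 0 := by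
    intro p
    rw [← ite_and]
    refine if_congr ?_ rfl rfl
    unfold Active
    rw [lt_sub_comm]
  unfold repeatedFlow
  simp only [key]
  split_ifs with h
  · rfl
  · refine (Finset.sum_eq_zero fun p _ => ?_).symm
    have h1 : (0 : ℝ) ≤ N.lengthTo p a := Nat.cast_nonneg _
    have h2 : (0 : ℝ) ≤ N.lengthFrom p a := Nat.cast_nonneg _
    rw [if_neg (c := _ ∧ _), ite_self]
    rintro ⟨h3, h4⟩
    exact h ⟨by linarith, by linarith⟩

open scoped Classical in
theorem integral_repeatedFlow (T : ℕ) (y : N.STPath → ℝ) (a : A) {α β : ℝ} (h : α ≤ β) :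
    ∫ θ in α..β, N.repeatedFlow T y a θ = ∑ p, y p * if a ∈ p.arcs then
      ramp (N.slack T p) (β - N.lengthTo p a) - ramp (N.slack T p) (α - N.lengthTo p a)
      else 0 := by
  simp only [repeatedFlow_eq_sum]
  rw [intervalIntegral.integral_finsetSum]
  · refine Finset.sum_congr rfl fun p _ => ?_
    split_ifs
    · rw [integral_ite_le_lt h, slack, ← lengthTo_add_lengthFrom p a]
      push_cast
      rw [show (T : ℝ) - N.lengthFrom p a - N.lengthTo p a =
        T - (N.lengthTo p a + N.lengthFrom p a) by ring]
    · simp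
  · intro p _
    split_ifs
    · exact intervalIntegrable_ite_le_lt _ _ _ _ _
    · exact intervalIntegrable_const

open scoped Classical in
/-- Each path delivers its rate during its slack. The source must differ from the sink: the empty
path has value `0` and slack `T`. -/
theorem value_repeatedFlow (hst : N.s ≠ N.t) (T : ℕ) (y : N.STPath → ℝ) :
    N.value T (N.repeatedFlow T y) = ∑ p, y p * N.slack T p := by
  -- Simple paths do not return to the source, and leave it only by their first arc.
  have hin : ∀ a, (if N.tgt a = N.s then
      ∫ θ in (0 : ℝ)..((T : ℝ) - N.transit a), N.repeatedFlow T y a θ else 0) = 0 := by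
    intro a
    split_ifs with ha
    · have : ∀ θ, N.repeatedFlow T y a θ = 0 := fun θ => by
        rw [repeatedFlow_eq_sum]
        exact Finset.sum_eq_zero fun p _ => if_neg fun hp => p.tgt_ne_source hp ha
      simp [this]
    · rfl
  have hout : ∀ p : N.STPath, (∑ a, if N.src a = N.s then (if a ∈ p.arcs then
      ramp (N.slack T p) (T - N.lengthTo p a) - ramp (N.slack T p) (0 - N.lengthTo p a)
      else 0) else 0) = N.slack T p := by
    rintro ⟨l, hl, hd⟩
    match l, hl, hd with
    | [], hl, _ => exact (hst hl).elim
    | b :: l, hl, hd =>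
      have hns : ∀ a ∈ l, N.src a ≠ N.s := by
        simp only [List.map_cons, List.nodup_cons, List.mem_cons, not_or] at hd
        exact src_ne_of_isWalk_of_nodup hl.2 (Ne.symm hd.1.1) hd.1.2
      rw [Finset.sum_eq_single b]
      · rw [if_pos hl.1, if_pos (by simp [STPath.arcs])]
        simp only [lengthTo, STPath.arcs, List.idxOf_cons_self, List.take_zero]
        have h1 : N.slack T ⟨b :: l, hl, hd⟩ ≤ T :=
          max_le (sub_le_self _ (Nat.cast_nonneg _)) (Nat.cast_nonneg _)
        have h2 := slack_nonneg (N := N) T ⟨b :: l, hl, hd⟩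
        simp [listLength, ramp, h1, h2]
      · intro a _ hab
        split_ifs with h1 h2
        · rcases List.mem_cons.1 h2 with h | h
          exacts [(hab h).elim, (hns a h h1).elim]
        · rfl
        · rfl
      · simp
  rw [value, Finset.sum_congr rfl fun a _ => hin a, Finset.sum_const_zero, sub_zero]
  simp only [integral_repeatedFlow T y _ (Nat.cast_nonneg (α := ℝ) T)]
  have : ∀ a, (if N.src a = N.s then ∑ p : N.STPath, y p * (if a ∈ p.arcs then
      ramp (N.slack T p) (T - N.lengthTo p a) - ramp (N.slack T p) (0 - N.lengthTo p a)
      else 0) else 0) = ∑ p : N.STPath, y p * if N.src a = N.s then (if a ∈ p.arcs then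
      ramp (N.slack T p) (T - N.lengthTo p a) - ramp (N.slack T p) (0 - N.lengthTo p a)
      else 0) else 0 := by
    intro a
    split_ifs <;> simp
  rw [Finset.sum_congr rfl fun a _ => this a, Finset.sum_comm]
  refine Finset.sum_congr rfl fun p _ => ?_
  rw [← Finset.mul_sum, hout]

/-- At time `θ`, the flow on a path `p` is the flow that entered `p` in the last `τ_p` time units:
the contributions of its arcs telescope. -/
theorem costAt_repeatedFlow (hcost : ∀ a, N.cost a = 1) (T : ℕ) (y : N.STPath → ℝ) (θ : ℝ) :
    N.costAt (N.repeatedFlow T y) θ =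
      ∑ p, y p * (ramp (N.slack T p) θ - ramp (N.slack T p) (θ - N.pathLength p)) := by
  classical
  have h : ∀ a, θ - N.transit a ≤ θ := fun a => sub_le_self _ (Nat.cast_nonneg _)
  simp only [costAt, hcost, Nat.cast_one, one_mul, integral_repeatedFlow T y _ (h _)]
  rw [Finset.sum_comm]
  refine Finset.sum_congr rfl fun p _ => ?_
  rw [← Finset.mul_sum, sum_ite_mem_eq _ p.nodup_arcs]
  congr 1
  have := sum_map_telescope (N := N) (fun x => ramp (N.slack T p) (θ - x)) p.nodup_arcs
  rw [sub_zero] at this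
  rw [pathLength, ← this]
  refine congrArg List.sum (List.map_congr_left fun a _ => ?_)
  rw [lengthTo, sub_sub θ (N.transit a : ℝ), add_comm (N.transit a : ℝ)]

/-- For unit costs, the costs of all paths peak simultaneously, at time `T / 2`. -/
theorem isGreatest_costs (hcost : ∀ a, N.cost a = 1) {T : ℕ} (hT : 0 < T) {y : N.STPath → ℝ}
    (hy : ∀ p, 0 ≤ y p) :
    IsGreatest (N.costs T (N.repeatedFlow T y)) (∑ p, y p * N.peakRate T p) := by
  have hT' : (0 : ℝ) < T := Nat.cast_pos.2 hT
  refine ⟨⟨T / 2, ⟨by positivity, by linarith⟩, ?_⟩, ?_⟩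
  · rw [costAt_repeatedFlow hcost]
    refine Finset.sum_congr rfl fun p _ => ?_
    rw [slack, ramp_half_sub_ramp _ _ (Nat.cast_nonneg _), peakRate, slack]
  · rintro _ ⟨θ, -, rfl⟩
    rw [costAt_repeatedFlow hcost]
    exact Finset.sum_le_sum fun p _ => mul_le_mul_of_nonneg_left
      (ramp_sub_ramp_le (slack_nonneg T p) (Nat.cast_nonneg _)) (hy p)

theorem peakCost_repeatedFlow (hcost : ∀ a, N.cost a = 1) {T : ℕ} (hT : 0 < T)
    {y : N.STPath → ℝ} (hy : ∀ p, 0 ≤ y p) :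
    N.peakCost T (N.repeatedFlow T y) = ∑ p, y p * N.peakRate T p :=
  (isGreatest_costs hcost hT hy).csSup_eq

end Network

/-! ### A Lagrange multiplier -/

/-- A Lagrange multiplier for the unit peak cost `min τ (T - τ)⁺` against the unit value `(T - τ)⁺`:
their ratio `lam` at the length `L` satisfies `lam * (T - τ)⁺ - min τ (T - τ)⁺ ≤ (lam + 1) (K - τ)⁺`
with `K = min L (T / 2)`, and equality holds up to the length `L`. -/
theorem exists_multiplier {T L : ℝ} (hL0 : 0 ≤ L) (hL : L < T) :
    ∃ lam K : ℝ, 0 ≤ lam ∧ K ≤ L ∧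
      (∀ τ, lam * max (T - τ) 0 - min τ (max (T - τ) 0) ≤ (lam + 1) * max (K - τ) 0) ∧
      ∀ τ, τ ≤ L → lam * max (T - τ) 0 - min τ (max (T - τ) 0) = (lam + 1) * max (K - τ) 0 := by
  rcases le_total L (T / 2) with h | h
  · -- Short last path: `K = L`, and the ratio of the two rates at `L` is `L / (T - L)`.
    have hTL : 0 < T - L := by linarith
    have hlam0 : 0 ≤ L / (T - L) := by positivity
    have hlam1 : L / (T - L) ≤ 1 := (div_le_one hTL).2 (by linarith)
    have hmul : L / (T - L) * (T - L) = L := div_mul_cancel₀ _ hTL.ne'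
    generalize L / (T - L) = lam at *
    refine ⟨lam, L, hlam0, le_rfl, fun τ => ?_, fun τ hτ => ?_⟩
    · have hr : 0 ≤ (lam + 1) * max (L - τ) 0 := by positivity
      rcases le_total τ (T / 2) with h' | h'
      · rw [max_eq_left (by linarith : 0 ≤ T - τ), min_eq_left (by linarith)]
        nlinarith [mul_le_mul_of_nonneg_left (le_max_left (L - τ) 0)
          (by linarith : 0 ≤ lam + 1)]
      · rw [min_eq_right (max_le (by linarith) (by linarith))]
        nlinarith [le_max_right (T - τ) 0]
    · rw [max_eq_left (by linarith : 0 ≤ T - τ), min_eq_left (by linarith),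
        max_eq_left (by linarith)]
      linarith
  · -- Beyond `T / 2` the two rates agree, so the ratio is `1`.
    have key : ∀ τ, 1 * max (T - τ) 0 - min τ (max (T - τ) 0) = (1 + 1) * max (T / 2 - τ) 0 := by
      intro τ
      grind
    exact ⟨1, T / 2, zero_le_one, h, fun τ => (key τ).le, fun τ _ => key τ⟩

namespace Network

variable {V A : Type*} {N : Network V A}

theorem STPath.isWalkIn_univ (p : N.STPath) : N.IsWalkIn Set.univ N.s p.arcs N.t :=
  ⟨p.2.1, fun _ _ => trivial⟩

theorem IsSeriesParallel.source_ne_sink (h : N.IsSeriesParallel) : N.s ≠ N.t :=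
  SPGraph.source_ne_sink h

theorem IsSeriesParallel.exists_stPath (h : N.IsSeriesParallel) {S : Set A} {l : List A}
    (hl : N.IsWalkIn S N.s l N.t) : ∃ p : N.STPath, p.arcs = l :=
  ⟨⟨l, hl.1, (hl.mono (Set.subset_univ S)).nodup h⟩, rfl⟩

theorem IsSeriesParallel.nonempty_stPath (h : N.IsSeriesParallel) : Nonempty N.STPath := by
  obtain ⟨l, hl⟩ := SPGraph.exists_isWalkIn h
  obtain ⟨p, -⟩ := h.exists_stPath hl
  exact ⟨p⟩

theorem STPath.exists_mem_arcs (hst : N.s ≠ N.t) (p : N.STPath) : ∃ a, a ∈ p.arcs := by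
  refine List.exists_mem_of_ne_nil _ fun h => hst ?_
  have := p.2.1
  rw [show p.1 = [] from h] at this
  exact this

variable [Fintype A]

/-! ### Free capacities and linear programming duality -/

/-- The arcs that are not saturated by `y`. -/
def freeArcs (N : Network V A) (y : N.STPath → ℝ) : Set A := {a | N.staticFlow y a < N.cap a}

theorem freeCap_le (y : N.STPath → ℝ) {p : N.STPath} {a : A} (ha : a ∈ p.arcs) :
    N.freeCap y p ≤ N.cap a - N.staticFlow y a :=
  ciInf_le (f := fun a : {a : A // a ∈ p.arcs} => (N.cap a.1 : ℝ) - N.staticFlow y a.1)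
    (Set.finite_range _).bddBelow ⟨a, ha⟩

theorem exists_freeCap_eq (hst : N.s ≠ N.t) (y : N.STPath → ℝ) (p : N.STPath) :
    ∃ a ∈ p.arcs, N.freeCap y p = N.cap a - N.staticFlow y a := by
  obtain ⟨a, ha⟩ := p.exists_mem_arcs hst
  have : Nonempty {a : A // a ∈ p.arcs} := ⟨⟨a, ha⟩⟩
  obtain ⟨b, hb⟩ := exists_eq_ciInf_of_finite
    (f := fun a : {a : A // a ∈ p.arcs} => (N.cap a.1 : ℝ) - N.staticFlow y a.1)
  exact ⟨b.1, b.2, hb.symm⟩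

theorem freeCap_pos_iff (hst : N.s ≠ N.t) (y : N.STPath → ℝ) (p : N.STPath) :
    0 < N.freeCap y p ↔ ∀ a ∈ p.arcs, a ∈ N.freeArcs y := by
  refine ⟨fun h a ha => sub_pos.1 (h.trans_le (freeCap_le y ha)), fun h => ?_⟩
  obtain ⟨a, ha, he⟩ := exists_freeCap_eq hst y p
  rw [he]
  exact sub_pos.2 (h a ha)

theorem staticFlow_mono {y z : N.STPath → ℝ} (h : ∀ p, y p ≤ z p) (a : A) :
    N.staticFlow y a ≤ N.staticFlow z a := by
  refine Finset.sum_le_sum fun p _ => ?_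
  split_ifs
  exacts [h p, le_rfl]

theorem sum_addRate_mul (y : N.STPath → ℝ) (p : N.STPath) (r : ℝ) (f : N.STPath → ℝ) :
    ∑ q, N.addRate y p r q * f q = ∑ q, y q * f q + r * f p := by
  classical
  have : ∀ q, N.addRate y p r q * f q = y q * f q + if q = p then r * f p else 0 := by
    intro q
    unfold addRate
    split_ifs with h
    · rw [h]; ring
    · ring
  rw [Finset.sum_congr rfl fun q _ => this q, Finset.sum_add_distrib]
  simp

open scoped Classical in
theorem staticFlow_eq_sum_mul (y : N.STPath → ℝ) (a : A) :
    N.staticFlow y a = ∑ p : N.STPath, y p * if a ∈ p.arcs then 1 else 0 := by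
  simp [staticFlow]

open scoped Classical in
theorem staticFlow_addRate (y : N.STPath → ℝ) (p : N.STPath) (r : ℝ) (a : A) :
    N.staticFlow (N.addRate y p r) a = N.staticFlow y a + if a ∈ p.arcs then r else 0 := by
  rw [staticFlow_eq_sum_mul, sum_addRate_mul, ← staticFlow_eq_sum_mul]
  simp

theorem sum_mul_weight (y : N.STPath → ℝ) (w : A → ℝ) :
    ∑ p, y p * weight w p.arcs = ∑ a, w a * N.staticFlow y a := by
  classical
  have : ∀ p : N.STPath, y p * weight w p.arcs =
      ∑ a, w a * if a ∈ p.arcs then y p else 0 := by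
    intro p
    rw [weight, ← sum_ite_mem_eq _ p.nodup_arcs, Finset.mul_sum]
    refine Finset.sum_congr rfl fun a _ => ?_
    split_ifs <;> ring
  rw [Finset.sum_congr rfl fun p _ => this p, Finset.sum_comm]
  simp only [staticFlow, Finset.mul_sum]

/-- Weak linear programming duality with complementary slackness: arc weights that dominate the
path rewards `(K - τ_p)⁺`, are tight on the paths used by `z`, and vanish on the arcs not saturated
by `z`, certify that `z` has the maximal reward. -/
theorem sum_mul_max_le_of_weight {x z : N.STPath → ℝ} (hx : N.IsPathDecomposition x)
    (hz : N.IsPathDecomposition z) {K : ℝ} {w : A → ℝ} (hw0 : ∀ a, 0 ≤ w a)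
    (hw : ∀ a, 0 < w a → a ∉ N.freeArcs z)
    (hK : ∀ q : N.STPath, K - N.pathLength q ≤ weight w q.arcs)
    (hzK : ∀ q : N.STPath, z q ≠ 0 → weight w q.arcs = K - N.pathLength q) :
    ∑ q, x q * max (K - N.pathLength q) 0 ≤ ∑ q, z q * max (K - N.pathLength q) 0 := by
  have hpos : ∀ l : List A, 0 ≤ weight w l := fun l =>
    List.sum_nonneg fun x hx => by obtain ⟨a, -, rfl⟩ := List.mem_map.1 hx; exact hw0 a
  calc ∑ q, x q * max (K - N.pathLength q) 0
      ≤ ∑ q, x q * weight w q.arcs := Finset.sum_le_sum fun q _ =>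
        mul_le_mul_of_nonneg_left (max_le (hK q) (hpos _)) (hx.1 q)
    _ = ∑ a, w a * N.staticFlow x a := sum_mul_weight x w
    _ ≤ ∑ a, w a * N.staticFlow z a := Finset.sum_le_sum fun a _ => by
        rcases (hw0 a).eq_or_lt with h | h
        · simp [← h]
        · exact mul_le_mul_of_nonneg_left ((hx.2 a).trans (not_lt.1 (hw a h))) h.le
    _ = ∑ q, z q * weight w q.arcs := (sum_mul_weight z w).symm
    _ ≤ ∑ q, z q * max (K - N.pathLength q) 0 := Finset.sum_le_sum fun q _ => by
        by_cases h : z q = 0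
        · simp [h]
        · rw [hzK q h]
          exact mul_le_mul_of_nonneg_left (le_max_left _ _) (hz.1 q)

/-! ### Greedy runs -/

/-- `y 0, …, y n` arise from the empty flow by adding, one after another, flow at the rates `r i`
along shortest paths `p i` with free capacity, respecting the capacities. -/
structure GreedyRun (N : Network V A) (n : ℕ) (y : ℕ → N.STPath → ℝ) (p : ℕ → N.STPath)
    (r : ℕ → ℝ) : Prop where
  zero : y 0 = fun _ => 0
  shortest : ∀ i < n, N.IsShortestFree (y i) (p i)
  rate_nonneg : ∀ i < n, 0 ≤ r i
  rate_le : ∀ i < n, r i ≤ N.freeCap (y i) (p i)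
  succ : ∀ i < n, y (i + 1) = N.addRate (y i) (p i) (r i)

namespace GreedyRun

variable {n : ℕ} {y : ℕ → N.STPath → ℝ} {p : ℕ → N.STPath} {r : ℕ → ℝ}

theorem of_le (h : N.GreedyRun n y p r) {m : ℕ} (hm : m ≤ n) : N.GreedyRun m y p r :=
  ⟨h.zero, fun i hi => h.shortest i (hi.trans_le hm), fun i hi => h.rate_nonneg i (hi.trans_le hm),
    fun i hi => h.rate_le i (hi.trans_le hm), fun i hi => h.succ i (hi.trans_le hm)⟩

theorem mono (h : N.GreedyRun n y p r) {i j : ℕ} (hij : i ≤ j) (hj : j ≤ n) (q : N.STPath) :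
    y i q ≤ y j q := by
  induction j, hij using Nat.le_induction with
  | base => exact le_rfl
  | succ j _ ih =>
    refine (ih (Nat.le_of_succ_le hj)).trans ?_
    rw [h.succ j hj, addRate]
    split_ifs
    exacts [le_add_of_nonneg_right (h.rate_nonneg j hj), le_rfl]

theorem freeArcs_subset (h : N.GreedyRun n y p r) {i j : ℕ} (hij : i ≤ j) (hj : j ≤ n) :
    N.freeArcs (y j) ⊆ N.freeArcs (y i) := fun a ha =>
  (staticFlow_mono (h.mono hij hj) a).trans_lt ha

theorem freeCap_pos_of_le (h : N.GreedyRun n y p r) (hst : N.s ≠ N.t) {i j : ℕ} (hij : i ≤ j)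
    (hj : j ≤ n) {q : N.STPath} (hq : 0 < N.freeCap (y j) q) : 0 < N.freeCap (y i) q := by
  rw [freeCap_pos_iff hst] at hq ⊢
  exact fun a ha => h.freeArcs_subset hij hj (hq a ha)

theorem isPathDecomposition (h : N.GreedyRun n y p r) : N.IsPathDecomposition (y n) := by
  induction n with
  | zero =>
    rw [h.zero]
    exact ⟨fun _ => le_rfl, fun a => by simp [staticFlow]⟩
  | succ n ih =>
    have ih := ih (h.of_le n.le_succ)
    refine ⟨fun q => (ih.1 q).trans (h.mono n.le_succ le_rfl q), fun a => ?_⟩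
    rw [h.succ n n.lt_succ_self, staticFlow_addRate]
    split_ifs with ha
    · linarith [h.rate_le n n.lt_succ_self, freeCap_le (y n) ha]
    · simpa using ih.2 a

theorem exists_of_ne_zero (h : N.GreedyRun n y p r) {q : N.STPath} (hq : y n q ≠ 0) :
    ∃ i < n, p i = q := by
  induction n with
  | zero => simp [h.zero] at hq
  | succ n ih =>
    by_cases hqp : q = p n
    · exact ⟨n, n.lt_succ_self, hqp.symm⟩
    · rw [h.succ n n.lt_succ_self, addRate, if_neg hqp] at hq
      obtain ⟨i, hi, he⟩ := ih (h.of_le n.le_succ) hq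
      exact ⟨i, hi.trans n.lt_succ_self, he⟩

/-- On series-parallel graphs, the greedy choice of shortest paths maximizes the total reward
`∑ y_p (K - τ_p)⁺` as soon as no path shorter than `K` has free capacity. -/
theorem sum_mul_max_le (hSP : N.IsSeriesParallel) (h : N.GreedyRun n y p r) {K : ℝ}
    (hK : ∀ q, 0 < N.freeCap (y n) q → K ≤ N.pathLength q) {x : N.STPath → ℝ}
    (hx : N.IsPathDecomposition x) :
    ∑ q, x q * max (K - N.pathLength q) 0 ≤ ∑ q, y n q * max (K - N.pathLength q) 0 := by
  classical
  have hst := hSP.source_ne_sink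
  -- Only the paths chosen as long as some path shorter than `K` was free are tight for the weights.
  have hex : ∃ m, ∀ q, 0 < N.freeCap (y m) q → K ≤ N.pathLength q := ⟨n, hK⟩
  set m := Nat.find hex with hm
  have hmn : m ≤ n := Nat.find_min' hex hK
  have hmK := Nat.find_spec hex
  rw [← hm] at hmK
  have hg := h.of_le hmn
  obtain ⟨w, hw0, hw, hwK, hwp⟩ := exists_arcWeights hSP (n := m) (F := fun i => N.freeArcs (y i))
    (fun i j hij hj => hg.freeArcs_subset hij hj) (I := {i | i < m}) (fun i hi => le_of_lt hi)
    (p := fun i => (p i).arcs) (K := K)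
    (fun i hi => ⟨(p i).2.1, fun a ha =>
      ⟨trivial, (freeCap_pos_iff hst _ _).1 (hg.shortest i hi).1 a ha⟩⟩)
    (fun i hi q hq => by
      obtain ⟨q, rfl⟩ := hSP.exists_stPath hq
      exact (hg.shortest i hi).2 q ((freeCap_pos_iff hst _ _).2 fun a ha => (hq.2 a ha).2))
    (fun i hi => by
      have := Nat.find_min hex hi
      push Not at this
      obtain ⟨q, hq, hqK⟩ := this
      exact le_trans (Nat.cast_le.2 ((hg.shortest i hi).2 q hq)) hqK.le)
    (fun q hq => by
      obtain ⟨q, rfl⟩ := hSP.exists_stPath hq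
      exact hmK q ((freeCap_pos_iff hst _ _).2 fun a ha => (hq.2 a ha).2))
  refine (sum_mul_max_le_of_weight hx hg.isPathDecomposition hw0 (fun a ha => hw a trivial ha)
    (fun q => hwK _ q.isWalkIn_univ) (fun q hq => ?_)).trans
    (Finset.sum_le_sum fun q _ =>
      mul_le_mul_of_nonneg_right (h.mono hmn le_rfl q) (le_max_right _ _))
  obtain ⟨i, hi, rfl⟩ := hg.exists_of_ne_zero hq
  exact hwp i hi

/-- While the demand of a feasible instance is not covered, there is a free path that is shorter
than the time horizon. -/
theorem exists_pathLength_lt (hSP : N.IsSeriesParallel) (h : N.GreedyRun n y p r) {T D : ℕ}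
    (hD : N.Feasible T D) (hlt : N.value T (N.repeatedFlow T (y n)) < D) :
    ∃ q, 0 < N.freeCap (y n) q ∧ N.pathLength q < T := by
  obtain ⟨_, ⟨x, hx, rfl⟩, hxD⟩ := hD
  by_contra! hno
  have := h.sum_mul_max_le hSP (K := T) (fun q hq => Nat.cast_le.2 (hno q hq)) hx
  rw [value_repeatedFlow hSP.source_ne_sink] at hlt hxD
  simp only [slack] at hlt hxD
  linarith

/-- A greedy run that ends with a path shorter than the time horizon has the least peak cost among
all path decompositions of at least the same value. -/
theorem sum_mul_peakRate_le (hSP : N.IsSeriesParallel) (h : N.GreedyRun (n + 1) y p r) {T : ℕ}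
    (hlen : N.pathLength (p n) < T) {x : N.STPath → ℝ} (hx : N.IsPathDecomposition x)
    (hle : ∑ q, y (n + 1) q * N.slack T q ≤ ∑ q, x q * N.slack T q) :
    ∑ q, y (n + 1) q * N.peakRate T q ≤ ∑ q, x q * N.peakRate T q := by
  have hst := hSP.source_ne_sink
  obtain ⟨lam, K, hlam, hKL, hall, heq⟩ := exists_multiplier
    (Nat.cast_nonneg (α := ℝ) (N.pathLength (p n))) (Nat.cast_lt.2 hlen)
  have hmax := h.sum_mul_max_le hSP (K := K) (fun q hq => hKL.trans (Nat.cast_le.2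
    ((h.shortest n n.lt_succ_self).2 q (h.freeCap_pos_of_le hst n.le_succ le_rfl hq)))) hx
  have hz : ∑ q, y (n + 1) q * N.peakRate T q = lam * ∑ q, y (n + 1) q * N.slack T q -
      (lam + 1) * ∑ q, y (n + 1) q * max (K - N.pathLength q) 0 := by
    rw [Finset.mul_sum, Finset.mul_sum, ← Finset.sum_sub_distrib]
    refine Finset.sum_congr rfl fun q _ => ?_
    by_cases hq : y (n + 1) q = 0
    · simp [hq]
    · obtain ⟨i, hi, rfl⟩ := h.exists_of_ne_zero hq
      have hL : (N.pathLength (p i) : ℝ) ≤ N.pathLength (p n) := Nat.cast_le.2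
        ((h.shortest i hi).2 _ (h.freeCap_pos_of_le hst (Nat.le_of_lt_succ hi) n.le_succ
          (h.shortest n n.lt_succ_self).1))
      have := heq _ hL
      rw [peakRate, slack]
      linear_combination (- y (n + 1) (p i)) * this
  have hxq : lam * ∑ q, x q * N.slack T q - (lam + 1) * ∑ q, x q * max (K - N.pathLength q) 0 ≤
      ∑ q, x q * N.peakRate T q := by
    rw [Finset.mul_sum, Finset.mul_sum, ← Finset.sum_sub_distrib]
    refine Finset.sum_le_sum fun q _ => ?_
    have := mul_le_mul_of_nonneg_left (hall (N.pathLength q)) (hx.1 q)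
    rw [peakRate, slack]
    linarith
  rw [hz]
  refine le_trans ?_ hxq
  have h1 := mul_le_mul_of_nonneg_left hle hlam
  have h2 := mul_le_mul_of_nonneg_left hmax (by linarith : 0 ≤ lam + 1)
  linarith

end GreedyRun

/-! ### The algorithm -/

theorem value_addRate (hst : N.s ≠ N.t) (T : ℕ) (y : N.STPath → ℝ) {p : N.STPath}
    (hp : N.pathLength p < T) (r : ℝ) : N.value T (N.repeatedFlow T (N.addRate y p r)) =
      N.value T (N.repeatedFlow T y) + r * (T - N.pathLength p) := by
  rw [value_repeatedFlow hst, value_repeatedFlow hst, sum_addRate_mul, slack,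
    max_eq_left (sub_nonneg.2 (Nat.cast_le.2 hp.le))]

/-- The rate by which an iteration of the algorithm increases the flow along `p`. -/
noncomputable def msspRate (N : Network V A) (T D : ℕ) (y : N.STPath → ℝ) (p : N.STPath) : ℝ :=
  min (N.freeCap y p) (((D : ℝ) - N.value T (N.repeatedFlow T y)) / ((T : ℝ) - N.pathLength p))

/-- Runs of the algorithm are greedy: since no iteration exceeds the demand, the rates are
nonnegative, and the instance being feasible, the chosen paths are shorter than the time horizon. -/
theorem MSSPRun.exists_greedyRun (hSP : N.IsSeriesParallel) {T D : ℕ} (hD : N.Feasible T D)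
    {n : ℕ} {y : ℕ → N.STPath → ℝ} (h : N.MSSPRun T D n y) :
    ∃ p, N.GreedyRun n y p (fun i => N.msspRate T D (y i) (p i)) ∧
      (∀ i < n, N.pathLength (p i) < T) ∧ N.value T (N.repeatedFlow T (y n)) ≤ D := by
  have hst := hSP.source_ne_sink
  have := hSP.nonempty_stPath
  obtain ⟨h0, hstep⟩ := h
  choose! hne p hp hy using hstep
  refine ⟨p, ?_⟩
  have key : ∀ k ≤ n, N.GreedyRun k y p (fun i => N.msspRate T D (y i) (p i)) ∧
      (∀ i < k, N.pathLength (p i) < T) ∧ N.value T (N.repeatedFlow T (y k)) ≤ D := by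
    intro k hk
    induction k with
    | zero =>
      refine ⟨⟨h0, by simp, by simp, by simp, by simp⟩, by simp, ?_⟩
      rw [value_repeatedFlow hst, h0]
      simp
    | succ k ih =>
      obtain ⟨hg, hlen, hval⟩ := ih (Nat.le_of_succ_le hk)
      obtain ⟨q, hq, hqT⟩ := hg.exists_pathLength_lt hSP hD (lt_of_le_of_ne hval (hne k hk))
      have hpT : N.pathLength (p k) < T := ((hp k hk).2 q hq).trans_lt hqT
      have hpos : (0 : ℝ) < T - N.pathLength (p k) := sub_pos.2 (Nat.cast_lt.2 hpT)
      have hforall : ∀ {P : ℕ → Prop}, (∀ i < k, P i) → P k → ∀ i < k + 1, P i := by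
        intro P h1 h2 i hi
        rcases Nat.lt_succ_iff_lt_or_eq.1 hi with hi | rfl
        exacts [h1 i hi, h2]
      refine ⟨⟨h0, hforall hg.shortest (hp k hk), hforall hg.rate_nonneg ?_,
        hforall hg.rate_le (min_le_left _ _), hforall hg.succ (hy k hk)⟩, hforall hlen hpT, ?_⟩
      · exact le_min (hp k hk).1.le (div_nonneg (sub_nonneg.2 hval) hpos.le)
      · rw [hy k hk, value_addRate hst T _ hpT]
        have := (le_div_iff₀ hpos).1 (min_le_right (N.freeCap (y k) (p k))
          (((D : ℝ) - N.value T (N.repeatedFlow T (y k))) / ((T : ℝ) - N.pathLength (p k))))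
        linarith
  exact key n le_rfl

/-- An iteration that does not reach the demand saturates an arc of its path. -/
theorem exists_saturated (hst : N.s ≠ N.t) {T D : ℕ} (y : N.STPath → ℝ) {p : N.STPath}
    (hp : N.pathLength p < T)
    (hne : N.value T (N.repeatedFlow T (N.addRate y p (N.msspRate T D y p))) ≠ D) :
    ∃ a ∈ p.arcs, a ∉ N.freeArcs (N.addRate y p (N.msspRate T D y p)) := by
  have hpos : (T : ℝ) - N.pathLength p ≠ 0 := (sub_pos.2 (Nat.cast_lt.2 hp)).ne'
  have hr : N.msspRate T D y p = N.freeCap y p := by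
    refine (min_choice _ _).resolve_right fun h => hne ?_
    rw [value_addRate hst T y hp, msspRate, h, div_mul_cancel₀ _ hpos]
    ring
  obtain ⟨a, ha, he⟩ := exists_freeCap_eq hst y p
  refine ⟨a, ha, ?_⟩
  rw [freeArcs, Set.mem_ofPred_eq, staticFlow_addRate, if_pos ha, hr, he]
  simp

/-- The iterations can be assigned distinct arcs: to every iteration but the last an arc that it
saturates, to the last one any arc of its path. -/
theorem MSSPRun.le_card (hSP : N.IsSeriesParallel) {T D : ℕ} (hD : N.Feasible T D)
    {n : ℕ} {y : ℕ → N.STPath → ℝ} (h : N.MSSPRun T D n y) : n ≤ Fintype.card A := by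
  have hst := hSP.source_ne_sink
  obtain ⟨p, hg, hlen, -⟩ := h.exists_greedyRun hSP hD
  have hex : ∀ i : Fin n, ∃ a ∈ N.freeArcs (y i), ∀ j : Fin n, i < j → a ∉ N.freeArcs (y j) := by
    intro i
    have hfree := (freeCap_pos_iff hst _ _).1 (hg.shortest i i.2).1
    by_cases hi : (i : ℕ) + 1 < n
    · have hne := (h.2 (i + 1) hi).1
      rw [hg.succ i i.2] at hne
      obtain ⟨a, ha, hsat⟩ := exists_saturated hst (y i) (hlen i i.2) hne
      refine ⟨a, hfree a ha, fun j hij haj => hsat ?_⟩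
      have := hg.freeArcs_subset (Nat.succ_le_of_lt hij) j.2.le haj
      rwa [Nat.succ_eq_add_one, hg.succ i i.2] at this
    · obtain ⟨a, ha⟩ := (p i).exists_mem_arcs hst
      exact ⟨a, hfree a ha, fun j hij => absurd (Fin.lt_def.1 hij) (by omega)⟩
  choose b hb hb' using hex
  have hinj : Function.Injective b := by
    intro i j hij
    rcases lt_trichotomy i j with hlt | rfl | hlt
    · exact (hb' i j hlt (hij ▸ hb j)).elim
    · rfl
    · exact (hb' j i hlt (hij ▸ hb i)).elim
  simpa using Fintype.card_le_of_injective b hinj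

theorem MSSPRun.exists_isShortestFree (hSP : N.IsSeriesParallel) {T D : ℕ} (hD : N.Feasible T D)
    {n : ℕ} {y : ℕ → N.STPath → ℝ} (h : N.MSSPRun T D n y)
    (hne : N.value T (N.repeatedFlow T (y n)) ≠ D) :
    (∃ p, N.IsShortestFree (y n) p) ∧ ∀ p, N.IsShortestFree (y n) p → N.pathLength p < T := by
  obtain ⟨p, hg, -, hval⟩ := h.exists_greedyRun hSP hD
  obtain ⟨q, hq, hqT⟩ := hg.exists_pathLength_lt hSP hD (lt_of_le_of_ne hval hne)
  obtain ⟨p', hp', hmin⟩ := Set.exists_min_image {q | 0 < N.freeCap (y n) q} N.pathLength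
    (Set.toFinite _) ⟨q, hq⟩
  exact ⟨⟨p', hp', hmin⟩, fun p hp => (hp.2 q hq).trans_lt hqT⟩

theorem MSSPRun.isOptimal (hSP : N.IsSeriesParallel) (hcost : ∀ a, N.cost a = 1) {T D : ℕ}
    (hT : 0 < T) (hD : N.Feasible T D) {n : ℕ} {y : ℕ → N.STPath → ℝ} (h : N.MSSPRun T D n y)
    (hval : N.value T (N.repeatedFlow T (y n)) = D) :
    N.IsOptimal T D (N.repeatedFlow T (y n)) := by
  have hst := hSP.source_ne_sink
  obtain ⟨p, hg, hlen, -⟩ := h.exists_greedyRun hSP hD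
  have hy := hg.isPathDecomposition
  refine ⟨⟨y n, hy, rfl⟩, hval.ge, ?_⟩
  rintro _ ⟨x, hx, rfl⟩ hxD
  rw [peakCost_repeatedFlow hcost hT hy.1, peakCost_repeatedFlow hcost hT hx.1]
  cases n with
  | zero =>
    simp only [hg.zero, zero_mul, Finset.sum_const_zero]
    exact Finset.sum_nonneg fun q _ => mul_nonneg (hx.1 q) (peakRate_nonneg T q)
  | succ n =>
    refine hg.sum_mul_peakRate_le hSP (hlen n n.lt_succ_self) hx ?_
    rw [← value_repeatedFlow hst, ← value_repeatedFlow hst, hval]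
    exact hxD

end Network
end PeakCostFlow

open PeakCostFlow in
theorem mainTheorem1 {V A : Type*} [Fintype A] (N : Network V A)
    (hSP : N.IsSeriesParallel) (hcost : ∀ a, N.cost a = 1)
    (T D : ℕ) (hT : 0 < T) (hD : N.Feasible T D) :
    -- every run stops after at most `|A|` iterations
    (∀ n y, N.MSSPRun T D n y → n ≤ Fintype.card A) ∧
    -- as long as the demand is not met, there is a path with free capacity, and every shortest
    -- such path is shorter than the time horizon
    (∀ n y, N.MSSPRun T D n y → N.value T (N.repeatedFlow T (y n)) ≠ D →
      (∃ p, N.IsShortestFree (y n) p) ∧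
        ∀ p, N.IsShortestFree (y n) p → N.pathLength p < T) ∧
    -- when the algorithm stops, it returns an optimal flow, which has value exactly `D`
    (∀ n y, N.MSSPRun T D n y → (¬ ∃ y', N.MSSPStep T D (y n) y') →
      N.IsPathDecomposition (y n) ∧
      N.value T (N.repeatedFlow T (y n)) = D ∧
      IsGreatest (N.costs T (N.repeatedFlow T (y n)))
        (N.peakCost T (N.repeatedFlow T (y n))) ∧
      N.IsOptimal T D (N.repeatedFlow T (y n))) := by
  refine ⟨fun n y h => h.le_card hSP hD, fun n y h => h.exists_isShortestFree hSP hD,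
    fun n y h hterm => ?_⟩
  obtain ⟨_, hg, -, -⟩ := h.exists_greedyRun hSP hD
  have hy := hg.isPathDecomposition
  have hval : N.value T (N.repeatedFlow T (y n)) = D := by
    by_contra hne
    obtain ⟨⟨p, hp⟩, -⟩ := h.exists_isShortestFree hSP hD hne
    exact hterm ⟨_, hne, p, hp, rfl⟩
  refine ⟨hy, hval, ?_, h.isOptimal hSP hcost hT hD hval⟩
  rw [Network.peakCost_repeatedFlow hcost hT hy.1]
  exact Network.isGreatest_costs hcost hT hy.1
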